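/- Let $X$ be a Hausdorff space, let $E$ be an equivalence relation on $X$ that is analytic (that is, as a subset of $X \times X$ it is empty or a continuous image of $\mathbb{N}^{\mathbb{N}}$), and let $F$ be an equivalence relation on $X$ that is Borel as a subset of the topological space $X \times X$. Let $\mathbb{E}_0$ be the equivalence relation on $2^{\mathbb{N}}$ given by $c \mathrel{\mathbb{E}_0} d \iff \exists n \in \mathbb{N}\ \forall m \ge n\ c(m) = d(m)$. Suppose that $\mathbb{E}_0$ does not continuously embed into $E$, i.e., there is no continuous injection $\pi \colon 2^{\mathbb{N}} \to X$ such that $c \mathrel{\mathbb{E}_0} d \iff \pi(c) \mathrel{E} \pi(d)$ for all $c, d \in 2^{\mathbb{N}}$. Suppose further that every $E$-class is a countable union of $(E \cap F)$-classes. Then $X$ is a countable union of $(E \cap F)$-invariant Borel partial transversals of $E$ over $E \cap F$, i.e., there are Borel sets $B_n \subseteq X$ (for $n \in \mathbb{N}$) such that $X = \bigcup_{n \in \mathbb{N}} B_n$ and, for every $n \in \mathbb{N}$, the set $B_n$ is a union of $(E \cap F)$-classes and the restrictions of $E$ and $E \cap F$ to $B_n$ coincide (any two $E$-related points of $B_n$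 are $F$-related). -/

import Mathlib

namespace QuotientDichotomy

/-- A subset of a topological space is Borel if it is in the smallest σ-algebra containing the
open sets. (For relations on `X` this is used with the product topology of `X × X`.) -/
def IsBorel {X : Type*} [TopologicalSpace X] (s : Set X) : Prop :=
  @MeasurableSet X (borel X) s

/-- An equivalence relation as a set of pairs. -/
def graph {X : Type*} (E : Setoid X) : Set (X × X) :=
  {p | E p.1 p.2}

/-- The equivalence relation `𝔼₀` of eventual equality on the Cantor space. -/
def E0 : Setoid (ℕ → Bool) where
  r c d := ∃ n : ℕ, ∀ m : ℕ, n ≤ m → c m = d m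
  iseqv :=
    { refl := fun _ => ⟨0, fun _ _ => rfl⟩
      symm := fun ⟨n, h⟩ => ⟨n, fun m hm => (h m hm).symm⟩
      trans := fun ⟨n, h⟩ ⟨k, h'⟩ => ⟨max n k, fun m hm =>
        (h m (le_trans (le_max_left n k) hm)).trans (h' m (le_trans (le_max_right n k) hm))⟩ }

/-- An embedding of `E` into `F` is an injection `π` with `w E x ↔ π w F π x`. -/
structure IsEmbedding {X Y : Type*} (E : Setoid X) (F : Setoid Y) (π : X → Y) : Prop where
  injective : Function.Injective π
  rel_iff : ∀ w x, E w x ↔ F (π w) (π x)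

/-- `E` continuously embeds into `F`. -/
def ContinuouslyEmbeds {X Y : Type*} [TopologicalSpace X] [TopologicalSpace Y]
    (E : Setoid X) (F : Setoid Y) : Prop :=
  ∃ π : X → Y, Continuous π ∧ IsEmbedding E F π

/-- Every `E`-class is a countable union of `F`-classes. -/
def ClassesAreCountableUnions {X : Type*} (E F : Setoid X) : Prop :=
  ∀ C ∈ E.classes, ∃ 𝒟 : Set (Set X), 𝒟.Countable ∧ 𝒟 ⊆ F.classes ∧ C = ⋃₀ 𝒟

/-- `Y` is `E`-invariant, i.e. a union of `E`-classes. -/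
def IsInvariant {X : Type*} (E : Setoid X) (Y : Set X) : Prop :=
  ∀ x y, E x y → (x ∈ Y ↔ y ∈ Y)

/-- `Y` is a partial transversal of `E` over the subequivalence relation `F`: the restrictions of
`E` and `F` to `Y` coincide. -/
def IsPartialTransversal {X : Type*} (E F : Setoid X) (Y : Set X) : Prop :=
  ∀ x ∈ Y, ∀ y ∈ Y, (E x y ↔ F x y)

end QuotientDichotomy

/-! The proof is a `𝔾₀`-dichotomy for the graph `E \ F`, with invariant Borel transversals in the
role of colours. For a sequence `s` dense in the binary tree, `𝔾₀` joins `c` to the sequence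
obtained by flipping `c k`, whenever `c k = false` and `c` extends `s k` restricted to `k`. Either
countably many transversals cover `X`, or a continuous `p` maps `𝔾₀` into `E \ F`
(`isCoSmall_empty_or_exists_homomorphism`).

To obtain `p`, sets covered by countably many transversals are discarded. An analytic set on which
`E` is contained in `F` is among these, by separation. If discarding never exhausts `X`, finite
approximations of a homomorphism can be doubled forever, and they converge.

Such a `p` contradicts the hypothesis on `𝔼₀`. An `F`-class pulls back to a Borel set containing no
edge of `𝔾₀`, hence to a meagre set; so do `E`-classes, being countable unions of `(E ⊓ F)`-classes.
By Kuratowski–Ulam the analytic pullback of `E` is meagre. It contains `𝔼₀`, which `𝔾₀` generates,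
and a fusion argument embeds `𝔼₀` into `E` (`continuouslyEmbeds_E0_of_isMeagre`). -/

open Set Filter Topology MeasureTheory

/-- Open sets of sequences in a discrete space depend locally on finitely many coordinates. -/
theorem IsOpen.exists_forall_eq_of_lt_imp_mem {α : Type*} [TopologicalSpace α]
    [DiscreteTopology α] {U : Set (ℕ → α)} (hU : IsOpen U) {x : ℕ → α} (hx : x ∈ U) :
    ∃ n, ∀ y : ℕ → α, (∀ i < n, y i = x i) → y ∈ U := by
  obtain ⟨_, ⟨y, n, rfl⟩, hxy, hy⟩ :=
    (PiNat.isTopologicalBasis_cylinders (fun _ : ℕ => α)).exists_subset_of_mem_open hx hU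
  exact ⟨n, fun w hw => hy fun i hi => (hw i hi).trans (hxy i hi)⟩

/-! ### Baire property of analytic sets and the Kuratowski–Ulam theorem -/

section Category

variable {X : Type*} [TopologicalSpace X]

/-- The set of points all of whose neighbourhoods meet `s` in a nonmeagre set. -/
def essentialClosure (s : Set X) : Set X :=
  {x | ∀ U, IsOpen U → x ∈ U → ¬ IsMeagre (s ∩ U)}

theorem isClosed_essentialClosure (s : Set X) : IsClosed (essentialClosure s) := by
  rw [← isOpen_compl_iff, isOpen_iff_forall_mem_open]
  intro x hx
  simp only [essentialClosure, mem_compl_iff, mem_ofPred_eq, not_forall, not_not] at hx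
  obtain ⟨U, hU, hxU, hm⟩ := hx
  exact ⟨U, fun y hy h => h U hU hy hm, hU, hxU⟩

theorem essentialClosure_subset_closure (s : Set X) : essentialClosure s ⊆ closure s := by
  intro x hx
  rw [mem_closure_iff]
  intro U hU hxU
  rw [inter_comm]
  exact nonempty_of_not_isMeagre (hx U hU hxU)

theorem isMeagre_diff_essentialClosure [SecondCountableTopology X] (s : Set X) :
    IsMeagre (s \ essentialClosure s) := by
  have hb := TopologicalSpace.isBasis_countableBasis X
  refine IsMeagre.mono (s := ⋃ U ∈ {U ∈ TopologicalSpace.countableBasis X | IsMeagre (s ∩ U)},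
    s ∩ U) ?_ (isMeagre_biUnion
      ((TopologicalSpace.countable_countableBasis X).mono (sep_subset _ _)) fun U hU => hU.2)
  rintro x ⟨hxs, hx⟩
  simp only [essentialClosure, mem_ofPred_eq, not_forall, not_not] at hx
  obtain ⟨U, hU, hxU, hm⟩ := hx
  obtain ⟨V, hV, hxV, hVU⟩ := hb.exists_subset_of_mem_open hxU hU
  exact mem_biUnion (show V ∈ {U ∈ TopologicalSpace.countableBasis X | IsMeagre (s ∩ U)} from
    ⟨hV, hm.mono (inter_subset_inter_right s hVU)⟩) ⟨hxs, hxV⟩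

/-- If the difference were dense in a nonempty open `W`, some `A i` would be nonmeagre in `W`; its
closed essential closure would then contain an open piece of `W`, and that piece would meet the
difference. -/
theorem isNowhereDense_essentialClosure_iUnion_diff [SecondCountableTopology X]
    {ι : Type*} [Countable ι] (A : ι → Set X) :
    IsNowhereDense (essentialClosure (⋃ i, A i) \ ⋃ i, essentialClosure (A i)) := by
  set M := essentialClosure (⋃ i, A i) \ ⋃ i, essentialClosure (A i)
  by_contra hM
  obtain ⟨x, hx⟩ : (interior (closure M)).Nonempty := nonempty_iff_ne_empty.2 hM
  obtain ⟨y, hyW, hyM⟩ := mem_closure_iff.1 (interior_subset hx) _ isOpen_interior hx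
  have h1 : ¬ IsMeagre ((⋃ i, A i) ∩ interior (closure M)) := hyM.1 _ isOpen_interior hyW
  rw [iUnion_inter] at h1
  obtain ⟨i, hi⟩ : ∃ i, ¬ IsMeagre (A i ∩ interior (closure M)) := by
    by_contra! h
    exact h1 (isMeagre_iUnion h)
  have h2 : ¬ IsMeagre (essentialClosure (A i) ∩ interior (closure M)) := by
    intro h
    refine hi ((h.union (isMeagre_diff_essentialClosure (A i))).mono ?_)
    rintro z ⟨hz, hzW⟩
    by_cases hz' : z ∈ essentialClosure (A i)
    · exact Or.inl ⟨hz', hzW⟩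
    · exact Or.inr ⟨hz, hz'⟩
  have h3 : ¬ IsNowhereDense (essentialClosure (A i) ∩ interior (closure M)) :=
    fun h => h2 h.isMeagre
  obtain ⟨z, hz⟩ := nonempty_iff_ne_empty.2 h3
  obtain ⟨w, hw, -, hwW⟩ := mem_closure_iff.1 (interior_subset hz) _ isOpen_interior hz
  obtain ⟨v, hv, hvM⟩ := mem_closure_iff.1 (interior_subset hwW) _ isOpen_interior hw
  refine hvM.2 (mem_iUnion.2 ⟨i, ?_⟩)
  exact (isClosed_essentialClosure (A i)).closure_subset
    (closure_mono inter_subset_left (interior_subset hv))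

/-- Analytic sets have the Baire property. -/
theorem MeasureTheory.AnalyticSet.baireMeasurableSet [SecondCountableTopology X] [T2Space X]
    {s : Set X} (hs : AnalyticSet s) : BaireMeasurableSet s := by
  rw [AnalyticSet] at hs
  obtain rfl | ⟨f, hf, rfl⟩ := hs
  · exact isOpen_empty.baireMeasurableSet
  -- `PiNat.res` lists the most recent value first, so `k :: l` extends `l` by one further value.
  let A : List ℕ → Set X := fun l => f '' {x | PiNat.res x l.length = l}
  have hA0 : A [] = range f := by simp [A]
  have hA : ∀ l, A l = ⋃ k, A (k :: l) := by
    intro l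
    ext x
    simp only [A, mem_image, mem_iUnion, mem_ofPred_eq, List.length_cons, PiNat.res_succ,
      List.cons.injEq]
    constructor
    · rintro ⟨y, hy, rfl⟩
      exact ⟨y l.length, y, ⟨rfl, hy⟩, rfl⟩
    · rintro ⟨k, y, ⟨-, hy⟩, rfl⟩
      exact ⟨y, hy, rfl⟩
  have hm : IsMeagre (⋃ l, essentialClosure (A l) \ ⋃ k, essentialClosure (A (k :: l))) := by
    refine isMeagre_iUnion fun l => ?_
    have := isNowhereDense_essentialClosure_iUnion_diff (fun k => A (k :: l))
    rw [← hA] at this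
    exact this.isMeagre
  -- Off the exceptional set, a point of the essential closure of `range f` follows a branch `z` of
  -- sets `A l` accumulating at it, and continuity forces `f z = x`.
  have key : essentialClosure (range f) \ range f ⊆
      ⋃ l, essentialClosure (A l) \ ⋃ k, essentialClosure (A (k :: l)) := by
    rintro x ⟨hx, hxf⟩
    by_contra hxM
    have hstep : ∀ l : {l // x ∈ essentialClosure (A l)}, ∃ k,
        x ∈ essentialClosure (A (k :: l.1)) := by
      rintro ⟨l, hl⟩
      by_contra hk
      exact hxM (mem_iUnion.2 ⟨l, hl, by simpa using hk⟩)
    choose k hk using hstep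
    let L : ℕ → {l // x ∈ essentialClosure (A l)} := fun n =>
      Nat.rec ⟨[], hA0 ▸ hx⟩ (fun _ l => ⟨k l :: l.1, hk l⟩) n
    let z : ℕ → ℕ := fun n => k (L n)
    have hz : ∀ n, PiNat.res z n = (L n).1 := by
      intro n
      induction n with
      | zero => rfl
      | succ n ih => rw [PiNat.res_succ, ih]
    refine hxf ⟨z, ?_⟩
    by_contra hne
    obtain ⟨U, V, hU, hV, hzU, hxV, hUV⟩ := t2_separation hne
    obtain ⟨n, hn⟩ := (hU.preimage hf).exists_forall_eq_of_lt_imp_mem hzU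
    have hxA : x ∈ closure (A (PiNat.res z n)) := by
      rw [hz]
      exact essentialClosure_subset_closure _ (L n).2
    obtain ⟨w, hwV, y, hy, rfl⟩ := mem_closure_iff.1 hxA V hV hxV
    exact hUV.ne_of_mem (hn y fun i hi => PiNat.res_eq_res.1 (by simpa using hy) hi) hwV rfl
  refine BaireMeasurableSet.congr
    (isClosed_essentialClosure (range f)).isOpen_compl.baireMeasurableSet.of_compl ?_
  have h1 : (essentialClosure (range f) \ range f)ᶜ ∈ residual X := hm.mono key
  have h2 : (range f \ essentialClosure (range f))ᶜ ∈ residual X :=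
    isMeagre_diff_essentialClosure (range f)
  rw [eventuallyEq_set]
  filter_upwards [h1, h2] with x hx1 hx2
  simp only [mem_compl_iff, Set.mem_sdiff, not_and, not_not] at hx1 hx2
  exact ⟨hx1, hx2⟩

variable {Y : Type*} [TopologicalSpace Y]

/-- The Kuratowski–Ulam theorem: almost all sections of a residual set are residual. -/
theorem eventually_residual_section [SecondCountableTopology Y] {R : Set (X × Y)}
    (hR : R ∈ residual (X × Y)) : ∀ᶠ x in residual X, {y | (x, y) ∈ R} ∈ residual Y := by
  obtain ⟨S, hSo, hSd, hSc, hSR⟩ := mem_residual_iff.1 hR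
  have key : ∀ O ∈ S, ∀ᶠ x in residual X, {y | (x, y) ∈ O} ∈ residual Y := by
    intro O hO
    -- A section is dense once it meets every basic `V`; for each `V` this holds on a dense open set
    -- of `x`.
    have h1 : ∀ V ∈ TopologicalSpace.countableBasis Y,
        ∀ᶠ x in residual X, ∃ y ∈ V, (x, y) ∈ O := by
      intro V hV
      have hVo := (TopologicalSpace.isBasis_countableBasis Y).isOpen hV
      have hVn := TopologicalSpace.nonempty_of_mem_countableBasis hV
      have heq : {x | ∃ y ∈ V, (x, y) ∈ O} = Prod.fst '' (O ∩ univ ×ˢ V) := by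
        ext x
        simp [and_comm]
      refine residual_of_dense_open (s := {x | ∃ y ∈ V, (x, y) ∈ O}) ?_ ?_
      · rw [heq]
        exact isOpenMap_fst _ ((hSo O hO).inter (isOpen_univ.prod hVo))
      · rw [dense_iff_inter_open]
        intro U hU hUn
        obtain ⟨⟨x, y⟩, ⟨hx, hy⟩, hO'⟩ :=
          (hSd O hO).inter_open_nonempty _ (hU.prod hVo) (hUn.prod hVn)
        exact ⟨x, hx, y, hy, hO'⟩
    filter_upwards [(eventually_countable_ball
      (TopologicalSpace.countable_countableBasis Y)).2 h1] with x hx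
    refine residual_of_dense_open ((hSo O hO).preimage (by fun_prop)) ?_
    refine (TopologicalSpace.isBasis_countableBasis Y).dense_iff.2 fun V hV _ => ?_
    obtain ⟨y, hy, hyO⟩ := hx V hV
    exact ⟨y, hy, hyO⟩
  filter_upwards [(eventually_countable_ball hSc).2 key] with x hx
  refine mem_of_superset ((countable_bInter_mem hSc).2 hx) fun y hy => hSR ?_
  simpa using hy

/-- A set with the Baire property all of whose vertical sections are meagre is meagre. -/
theorem BaireMeasurableSet.isMeagre_of_forall_section [BaireSpace X] [BaireSpace Y]
    [SecondCountableTopology Y] {s : Set (X × Y)} (hs : BaireMeasurableSet s)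
    (h : ∀ x, IsMeagre {y | (x, y) ∈ s}) : IsMeagre s := by
  obtain ⟨U, hU, hsU⟩ := hs.residualEq_isOpen
  rw [eventuallyEq_set] at hsU
  have hU0 : U = ∅ := by
    by_contra hne
    obtain ⟨⟨x₀, y₀⟩, hp⟩ := nonempty_iff_ne_empty.2 hne
    obtain ⟨V, W, hV, hW, hxV, hyW, hVW⟩ := isOpen_prod_iff.1 hU x₀ y₀ hp
    obtain ⟨x, hxV', hx⟩ := (dense_of_mem_residual
      (eventually_residual_section hsU)).inter_open_nonempty V hV ⟨x₀, hxV⟩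
    obtain ⟨y, hyW', hy, hys⟩ := (dense_of_mem_residual
      (inter_mem hx (h x))).inter_open_nonempty W hW ⟨y₀, hyW⟩
    exact hys (hy.2 (hVW ⟨hxV', hyW'⟩))
  filter_upwards [hsU] with p hp hps
  simpa [hU0] using hp.1 hps

end Category

/-! ### From homomorphisms of `𝔾₀` to embeddings of `𝔼₀` -/

section Cantor

open QuotientDichotomy

/-- The homeomorphism of the Cantor space that flips the coordinates in `S`. -/
def flipCoords (S : Finset ℕ) : (ℕ → Bool) ≃ₜ (ℕ → Bool) where
  toFun c i := xor (c i) (decide (i ∈ S))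
  invFun c i := xor (c i) (decide (i ∈ S))
  left_inv c := by ext i; simp
  right_inv c := by ext i; simp
  continuous_toFun := continuous_pi fun i =>
    (continuous_of_discreteTopology (f := fun b : Bool => xor b (decide (i ∈ S)))).comp
      (continuous_apply i)
  continuous_invFun := continuous_pi fun i =>
    (continuous_of_discreteTopology (f := fun b : Bool => xor b (decide (i ∈ S)))).comp
      (continuous_apply i)

theorem flipCoords_apply (S : Finset ℕ) (c : ℕ → Bool) (i : ℕ) :
    flipCoords S c i = xor (c i) (decide (i ∈ S)) := rfl

@[simp]
theorem flipCoords_flipCoords (S : Finset ℕ) (c : ℕ → Bool) :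
    flipCoords S (flipCoords S c) = c := (flipCoords S).left_inv c

theorem isOpen_setOf_forall_lt_eq (x : ℕ → Bool) (n : ℕ) :
    IsOpen {c : ℕ → Bool | ∀ i < n, c i = x i} :=
  PiNat.isOpen_cylinder (fun _ => Bool) x n

/-- The sequences `s k` restricted to `k` are dense in the binary tree. -/
def IsDenseInTree (s : ℕ → ℕ → Bool) : Prop :=
  ∀ (c : ℕ → Bool) (m : ℕ), ∃ k, m ≤ k ∧ ∀ i < m, s k i = c i

theorem exists_isDenseInTree : ∃ s, IsDenseInTree s := by
  -- `s k` is the list coded by the first component of `k`, padded with `false`; the second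
  -- component is free and serves to make `k` at least `m`.
  refine ⟨fun k i => ((Encodable.decode (α := List Bool) k.unpair.1).getD []).getD i false,
    fun c m => ⟨Nat.pair (Encodable.encode (List.ofFn fun i : Fin m => c i)) m,
      Nat.right_le_pair _ _, fun i hi => ?_⟩⟩
  simp [hi]

/-- A nonmeagre set with the Baire property contains an edge of the graph `𝔾₀` induced by a dense
sequence `s`. -/
theorem IsDenseInTree.exists_flipCoords_mem {s : ℕ → ℕ → Bool} (hs : IsDenseInTree s)
    {A : Set (ℕ → Bool)} (hA : BaireMeasurableSet A) (hne : ¬ IsMeagre A) :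
    ∃ k, ∃ c ∈ A, flipCoords {k} c ∈ A ∧ c k = false ∧ ∀ i < k, c i = s k i := by
  obtain ⟨U, hU, hAU⟩ := hA.residualEq_isOpen
  rw [eventuallyEq_set] at hAU
  have hUn : U.Nonempty := by
    rw [nonempty_iff_ne_empty]
    rintro rfl
    refine hne ?_
    filter_upwards [hAU] with c hc hcA
    simpa using hc.1 hcA
  obtain ⟨x, hx⟩ := hUn
  obtain ⟨m, hm⟩ := hU.exists_forall_eq_of_lt_imp_mem hx
  obtain ⟨k, hmk, hk⟩ := hs x m
  have hflip : ∀ᶠ c in residual (ℕ → Bool), (flipCoords {k} c ∈ A ↔ flipCoords {k} c ∈ U) :=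
    tendsto_residual_of_isOpenMap (flipCoords {k}).continuous (flipCoords {k}).isOpenMap hAU
  -- This cylinder fixes `c` up to and including coordinate `k`. As `m ≤ k`, both `c` and its flip
  -- at `k` still lie in `U`.
  have hV : IsOpen {c : ℕ → Bool | ∀ i < k + 1, c i = (fun i => if i = k then false else s k i) i} :=
    isOpen_setOf_forall_lt_eq _ _
  obtain ⟨c, hcV, hc1, hc2⟩ := (dense_of_mem_residual (inter_mem hAU hflip)).inter_open_nonempty _
    hV ⟨_, fun _ _ => rfl⟩
  have hck : c k = false := by simpa using hcV k k.lt_succ_self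
  have hcs : ∀ i < k, c i = s k i := fun i hi => by simpa [hi.ne] using hcV i (hi.trans k.lt_succ_self)
  refine ⟨k, c, hc1.2 (hm c fun i hi => ?_), hc2.2 (hm _ fun i hi => ?_), hck, hcs⟩
  · rw [hcs i (hi.trans_le hmk), hk i hi]
  · rw [flipCoords_apply, hcs i (hi.trans_le hmk), hk i hi]
    simp [(hi.trans_le hmk).ne]

/-- An equivalence relation containing the graph `𝔾₀` contains `𝔼₀`. -/
theorem rel_of_E0 {s : ℕ → ℕ → Bool} (R : Setoid (ℕ → Bool))
    (h : ∀ k c, c k = false → (∀ i < k, c i = s k i) → R c (flipCoords {k} c))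
    {c d : ℕ → Bool} (hcd : E0 c d) : R c d := by
  obtain ⟨n, hn⟩ := hcd
  induction n generalizing c d with
  | zero =>
    rw [show c = d from funext fun i => hn i i.zero_le]
  | succ n ih =>
    have main : ∀ c d : ℕ → Bool, (∀ m, n + 1 ≤ m → c m = d m) → c n = false → d n = true →
        R c d := by
      intro c d hcd hc hd
      -- The induction hypothesis allows the first `n` coordinates to be replaced by those of `s n`,
      -- where flipping coordinate `n` is an edge of `𝔾₀`.
      let c' : ℕ → Bool := fun i => if i < n then s n i else c i
      have h1 : R c c' := ih fun m hm => by simp [c', hm.not_gt]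
      have h2 : R c' (flipCoords {n} c') := h n c' (by simp [c', hc]) fun i hi => by simp [c', hi]
      have h3 : R (flipCoords {n} c') d := ih fun m hm => by
        rcases hm.eq_or_lt with rfl | hm'
        · simp [flipCoords_apply, c', hc, hd]
        · simp [flipCoords_apply, c', hm.not_gt, hm'.ne', hcd m hm']
      exact R.trans h1 (R.trans h2 h3)
    rcases hc : c n with _ | _ <;> rcases hd : d n with _ | _
    · exact ih fun m hm => hm.eq_or_lt.elim (fun e => by rw [← e, hc, hd]) (hn m)
    · exact main c d hn hc hd
    · exact R.symm (main d c (fun m hm => (hn m hm).symm) hd hc)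
    · exact ih fun m hm => hm.eq_or_lt.elim (fun e => by rw [← e, hc, hd]) (hn m)

/-- Membership in a dense open subset of the square of the Cantor space can be forced by prescribing
the coordinates in a finite interval beyond any given one. -/
theorem exists_block_forall_mem {O : Set ((ℕ → Bool) × (ℕ → Bool))} (ho : IsOpen O) (hd : Dense O)
    (l : ℕ) : ∃ (x : Bool → ℕ → Bool) (l' : ℕ), l < l' ∧ ∀ y z : ℕ → Bool,
      (∀ i, l ≤ i → i < l' → y i = x false i) → (∀ i, l ≤ i → i < l' → z i = x true i) →
      (y, z) ∈ O := by
  -- All alterations of the first `l` coordinates are handled at once: finitely many translates of a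
  -- dense open set have dense open intersection.
  let P : Finset (Finset ℕ × Finset ℕ) := (Finset.range l).powerset ×ˢ (Finset.range l).powerset
  let h : Finset ℕ × Finset ℕ → ((ℕ → Bool) × (ℕ → Bool)) ≃ₜ ((ℕ → Bool) × (ℕ → Bool)) :=
    fun q => (flipCoords q.1).prodCongr (flipCoords q.2)
  have hO : IsOpen (⋂ q ∈ P, h q ⁻¹' O) :=
    isOpen_biInter_finset fun q _ => ho.preimage (h q).continuous
  have hD : Dense (⋂ q ∈ P, h q ⁻¹' O) :=
    dense_biInter_of_isOpen (S := (P : Set (Finset ℕ × Finset ℕ)))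
      (fun q _ => ho.preimage (h q).continuous) P.countable_toSet
      fun q _ => hd.preimage (h q).isOpenMap
  obtain ⟨⟨x₀, x₁⟩, hx⟩ := hD.nonempty
  obtain ⟨U, V, hU, hV, hxU, hxV, hUV⟩ := isOpen_prod_iff.1 hO x₀ x₁ hx
  obtain ⟨m, hm⟩ := hU.exists_forall_eq_of_lt_imp_mem hxU
  obtain ⟨n, hn⟩ := hV.exists_forall_eq_of_lt_imp_mem hxV
  have hfix : ∀ (k : ℕ) (x y : ℕ → Bool),
      (∀ i, l ≤ i → i < max (l + 1) (max m n) → y i = x i) → k ≤ max m n →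
      ∀ i < k, flipCoords {i ∈ Finset.range l | y i ≠ x i} y i = x i := by
    intro k x y hy hk i hi
    rw [flipCoords_apply]
    by_cases hil : i < l
    · cases hyi : y i <;> cases hxi : x i <;> simp [hil, hyi, hxi]
    · rw [hy i (not_lt.1 hil) (by omega)]
      simp [hil]
  refine ⟨fun b => bif b then x₁ else x₀, max (l + 1) (max m n), by omega, fun y z hy hz => ?_⟩
  have hmem := hUV (mk_mem_prod (hm _ (hfix m x₀ y hy (le_max_left _ _)))
    (hn _ (hfix n x₁ z hz (le_max_right _ _))))
  have := mem_iInter₂.1 hmem ({i ∈ Finset.range l | y i ≠ x₀ i}, {i ∈ Finset.range l | z i ≠ x₁ i})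
    (by simp [P])
  simpa [h] using this

/-- If an equivalence relation `E` pulls back along a continuous function on the Cantor space to a
meagre relation containing `𝔼₀`, then `𝔼₀` continuously embeds into `E`. -/
theorem continuouslyEmbeds_E0_of_isMeagre {X : Type*} [TopologicalSpace X] [T2Space X]
    {E : Setoid X} {p : (ℕ → Bool) → X} (hp : Continuous p)
    (hE0 : ∀ c d, E0 c d → E (p c) (p d))
    (hm : IsMeagre {q : (ℕ → Bool) × (ℕ → Bool) | E (p q.1) (p q.2)}) :
    ContinuouslyEmbeds E0 E := by
  obtain ⟨t, htE, htG, htd⟩ := mem_residual.1 hm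
  obtain ⟨f, hfo, hf⟩ := isGδ_iff_eq_iInter_nat.1 htG
  let K : Set ((ℕ → Bool) × (ℕ → Bool)) := {q | p q.1 ≠ p q.2}
  have hK : IsOpen K := isOpen_ne_fun (by fun_prop) (by fun_prop)
  -- The factor `K` will give injectivity, and the sets `f i` will give non-equivalence when
  -- coordinates differ infinitely often.
  let O : ℕ → Set ((ℕ → Bool) × (ℕ → Bool)) := fun n => K ∩ ⋂ i ∈ Finset.range (n + 1), f i
  have hOo : ∀ n, IsOpen (O n) := fun n =>
    hK.inter (isOpen_biInter_finset fun i _ => hfo i)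
  have hOd : ∀ n, Dense (O n) := by
    refine fun n => htd.mono fun q hq => ⟨fun he => htE hq ?_, ?_⟩
    · change E (p q.1) (p q.2)
      rw [he]
    · rw [hf] at hq
      exact mem_iInter₂.2 fun i _ => mem_iInter.1 hq i
  choose x next hlt hx using fun n l => exists_block_forall_mem (hOo n) (hOd n) l
  let l : ℕ → ℕ := fun n => Nat.rec 0 (fun n m => next n m) n
  have hl : ∀ n, l (n + 1) = next n (l n) := fun _ => rfl
  have hmono : StrictMono l := strictMono_nat_of_lt_succ fun n => hlt n (l n)
  have hex : ∀ j, ∃ n, j < l (n + 1) := fun j => ⟨j, (hmono.id_le (j + 1))⟩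
  let N : ℕ → ℕ := fun j => Nat.find (hex j)
  have hN : ∀ n j, l n ≤ j → j < l (n + 1) → N j = n := fun n j h1 h2 =>
    (Nat.find_eq_iff _).2 ⟨h2, fun m hmn => (((hmono.monotone hmn).trans h1).not_gt)⟩
  have hN' : ∀ n j, l n ≤ j → n ≤ N j := fun n j h1 =>
    (Nat.le_find_iff _ _).2 fun m hmn => (((hmono.monotone hmn).trans h1).not_gt)
  -- On the block from `l n` to `l (n + 1)`, `ψ c` copies the pattern selected by `c n`.
  let ψ : (ℕ → Bool) → ℕ → Bool := fun c j => x (N j) (l (N j)) (c (N j)) j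
  have hψ : Continuous ψ := continuous_pi fun j =>
    (continuous_of_discreteTopology (f := fun b : Bool => x (N j) (l (N j)) b j)).comp
      (continuous_apply (N j))
  have hO : ∀ c d n, c n = false → d n = true → (ψ c, ψ d) ∈ O n := by
    intro c d n hc hd
    refine hx n (l n) _ _ (fun i h1 h2 => ?_) fun i h1 h2 => ?_
    · simp only [ψ, hN n i h1 h2, hc]
    · simp only [ψ, hN n i h1 h2, hd]
  have hO' : ∀ c d n, c n ≠ d n → (ψ c, ψ d) ∈ O n ∨ (ψ d, ψ c) ∈ O n := by
    intro c d n hcd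
    rcases hc : c n with _ | _ <;> rcases hd : d n with _ | _
    · exact absurd (hc.trans hd.symm) hcd
    · exact Or.inl (hO c d n hc hd)
    · exact Or.inr (hO d c n hd hc)
    · exact absurd (hc.trans hd.symm) hcd
  refine ⟨p ∘ ψ, hp.comp hψ, fun c d hcd => ?_, fun c d => ⟨fun h => hE0 _ _ ?_, fun h => ?_⟩⟩
  · by_contra hne
    obtain ⟨n, hn⟩ := Function.ne_iff.1 hne
    rcases hO' c d n hn with h | h
    · exact h.1 hcd
    · exact h.1 hcd.symm
  · obtain ⟨n, hn⟩ := h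
    refine ⟨l n, fun j hj => ?_⟩
    simp only [ψ, hn _ (hN' n j hj)]
  -- The dense `Gδ` set `t` need not be symmetric, so both orders of the pair are considered.
  · have hout : ∀ q : (ℕ → Bool) × (ℕ → Bool), E (p q.1) (p q.2) → ∃ n, q ∉ f n := by
      intro q hq
      have : q ∉ t := fun hqt => htE hqt hq
      simpa [hf] using this
    obtain ⟨n₁, h₁⟩ := hout (ψ c, ψ d) h
    obtain ⟨n₂, h₂⟩ := hout (ψ d, ψ c) (E.symm h)
    refine ⟨max n₁ n₂, fun m hm => ?_⟩
    by_contra hne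
    rcases hO' c d m hne with h | h
    · exact h₁ (mem_iInter₂.1 h.2 n₁ (by simp; omega))
    · exact h₂ (mem_iInter₂.1 h.2 n₂ (by simp; omega))

instance : PolishSpace Bool :=
  (IsClosedEmbedding.of_continuous_injective_isClosedMap (f := Bool.toNat)
    continuous_of_discreteTopology (fun a b => by cases a <;> cases b <;> simp)
    fun _ _ => isClosed_discrete _).polishSpace

/-- If `E` is analytic, `F` is Borel, every `E`-class is a countable union of `E ⊓ F`-classes and
there is a continuous homomorphism from the graph `𝔾₀` to `E \ F`, then `𝔼₀` continuously embeds
into `E`. -/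
theorem continuouslyEmbeds_E0_of_homomorphism {X : Type*} [TopologicalSpace X] [T2Space X]
    {E F : Setoid X} (hE : AnalyticSet (graph E)) (hF : IsBorel (graph F))
    (hEF : ClassesAreCountableUnions E (E ⊓ F)) {s : ℕ → ℕ → Bool} (hs : IsDenseInTree s)
    {p : (ℕ → Bool) → X} (hp : Continuous p)
    (hom : ∀ k c, c k = false → (∀ i < k, c i = s k i) →
      E (p c) (p (flipCoords {k} c)) ∧ ¬ F (p c) (p (flipCoords {k} c))) :
    ContinuouslyEmbeds E0 E := by
  refine continuouslyEmbeds_E0_of_isMeagre hp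
    (fun c d hcd => rel_of_E0 (E.comap p) (fun k c h1 h2 => (hom k c h1 h2).1) hcd) ?_
  -- A nonmeagre `F`-class would contain both ends of an edge of `𝔾₀`, which `p` sends outside `F`.
  have hclass : ∀ x, IsMeagre {d | F x (p d)} := by
    intro x
    by_contra hne
    have hb : BaireMeasurableSet {d | F x (p d)} := by
      borelize (ℕ → Bool)
      have hc : Continuous fun d => (x, p d) := by fun_prop
      let : MeasurableSpace (X × X) := borel (X × X)
      have : BorelSpace (X × X) := ⟨rfl⟩
      exact (hc.measurable hF).baireMeasurableSet
    obtain ⟨k, c, hc, hc', h1, h2⟩ := hs.exists_flipCoords_mem hb hne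
    exact (hom k c h1 h2).2 (F.trans (F.symm hc) hc')
  have han : AnalyticSet {q : (ℕ → Bool) × (ℕ → Bool) | E (p q.1) (p q.2)} :=
    hE.preimage (f := fun q : (ℕ → Bool) × (ℕ → Bool) => (p q.1, p q.2)) (by fun_prop)
  refine han.baireMeasurableSet.isMeagre_of_forall_section fun c => ?_
  obtain ⟨D, hDc, hD, hCD⟩ := hEF {y | E y (p c)} (E.mem_classes (p c))
  refine (isMeagre_biUnion hDc (f := fun C => {d | p d ∈ C}) fun C hC => ?_).mono ?_
  · obtain ⟨x, rfl⟩ := hD hC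
    exact (hclass x).mono fun d hd => F.symm hd.2
  · intro d hd
    have : p d ∈ ⋃₀ D := hCD ▸ E.symm hd
    simpa using this

end Cantor

/-! ### Separation by invariant Borel sets, and countable unions of transversals -/

section Separation

open QuotientDichotomy

variable {X : Type*} [TopologicalSpace X]

/-- Since `X` need not be Polish, the Borel set is pulled back to the Baire space, where Borel sets
are analytic. -/
theorem MeasureTheory.AnalyticSet.inter_isBorel {s t : Set X} (hs : AnalyticSet s)
    (ht : IsBorel t) : AnalyticSet (s ∩ t) := by
  rw [AnalyticSet] at hs
  obtain rfl | ⟨f, hf, rfl⟩ := hs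
  · simpa using analyticSet_empty
  · rw [inter_comm, ← image_preimage_eq_inter_range]
    borelize X (ℕ → ℕ)
    exact (hf.measurable ht).analyticSet.image_of_continuous hf

/-- The image of an analytic set under an analytic relation is analytic. -/
theorem MeasureTheory.AnalyticSet.image_of_rel [T2Space X] {R : Set (X × X)} (hR : AnalyticSet R)
    {A : Set X} (hA : AnalyticSet A) : AnalyticSet {y | ∃ x ∈ A, (x, y) ∈ R} := by
  rw [AnalyticSet] at hR
  obtain rfl | ⟨f, hf, rfl⟩ := hR
  · simpa using analyticSet_empty
  · convert! (hA.preimage (f := fun z => (f z).1) (by fun_prop)).image_of_continuous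
      (f := fun z => (f z).2) (by fun_prop) using 1
    ext y
    constructor
    · rintro ⟨x, hx, z, hz⟩
      exact ⟨z, by simpa [hz] using hx, by simp [hz]⟩
    · rintro ⟨z, hz, rfl⟩
      exact ⟨_, hz, z, rfl⟩

theorem analyticSet_univ_of_graph {E : Setoid X} (hE : AnalyticSet (graph E)) :
    AnalyticSet (univ : Set X) := by
  convert hE.image_of_continuous continuous_fst using 1
  exact (eq_univ_of_forall fun x =>
    (⟨(x, x), E.refl x, rfl⟩ : x ∈ Prod.fst '' graph E)).symm

/-- An analytic set disjoint from an analytic set that is invariant under an analytic equivalence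
relation is contained in a disjoint invariant Borel set. -/
theorem exists_isInvariant_isBorel_separating [T2Space X] {H : Setoid X}
    (hH : AnalyticSet (graph H)) {A C : Set X} (hA : AnalyticSet A) (hC : AnalyticSet C)
    (hCH : IsInvariant H C) (hAC : Disjoint A C) :
    ∃ B, IsBorel B ∧ IsInvariant H B ∧ A ⊆ B ∧ Disjoint B C := by
  borelize X
  have hsep : ∀ S : {S : Set X // AnalyticSet S ∧ Disjoint S C}, ∃ u, S.1 ⊆ u ∧ Disjoint C u ∧
      MeasurableSet u := fun S => S.2.1.measurablySeparable hC S.2.2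
  choose u hSu hCu hu using hsep
  have hstep : ∀ S : {S : Set X // AnalyticSet S ∧ Disjoint S C},
      AnalyticSet {y | ∃ x ∈ u S, (x, y) ∈ graph H} ∧
        Disjoint {y | ∃ x ∈ u S, (x, y) ∈ graph H} C := by
    intro S
    refine ⟨hH.image_of_rel ?_, ?_⟩
    · simpa using (analyticSet_univ_of_graph hH).inter_isBorel (hu S)
    · rw [disjoint_left]
      rintro y ⟨x, hx, hxy⟩ hy
      exact disjoint_left.1 (hCu S) ((hCH x y hxy).2 hy) hx
  -- Borel separation alternates with saturation under `H`; saturating preserves disjointness from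
  -- the invariant set `C`, and the union of the stages is invariant.
  let S : ℕ → {S : Set X // AnalyticSet S ∧ Disjoint S C} :=
    fun n => Nat.rec ⟨A, hA, hAC⟩ (fun _ S => ⟨_, hstep S⟩) n
  have hinv : ∀ x y, H x y → x ∈ ⋃ n, u (S n) → y ∈ ⋃ n, u (S n) := by
    intro x y hxy hx
    obtain ⟨n, hn⟩ := mem_iUnion.1 hx
    exact mem_iUnion.2 ⟨n + 1, hSu (S (n + 1)) ⟨x, hn, hxy⟩⟩
  refine ⟨⋃ n, u (S n), MeasurableSet.iUnion fun n => hu (S n),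
    fun x y hxy => ⟨hinv x y hxy, hinv y x (H.symm hxy)⟩,
    (hSu (S 0)).trans (subset_iUnion (fun n => u (S n)) 0), ?_⟩
  rw [disjoint_iUnion_left]
  exact fun n => (hCu (S n)).symm

/-- An `E ⊓ F`-invariant Borel partial transversal of `E` over `E ⊓ F`. -/
structure IsBorelTransversal (E F : Setoid X) (B : Set X) : Prop where
  isBorel : IsBorel B
  isInvariant : IsInvariant (E ⊓ F) B
  isPartialTransversal : IsPartialTransversal E (E ⊓ F) B

theorem analyticSet_graph_inf {E F : Setoid X} (hE : AnalyticSet (graph E))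
    (hF : IsBorel (graph F)) : AnalyticSet (graph (E ⊓ F)) :=
  hE.inter_isBorel hF

theorem analyticSet_graph_diff {E F : Setoid X} (hE : AnalyticSet (graph E))
    (hF : IsBorel (graph F)) : AnalyticSet (graph E \ graph F) :=
  hE.inter_isBorel (MeasurableSet.compl hF)

/-- `E` is contained in `F` on `A`. -/
def RelLEOn {X : Type*} (E F : Setoid X) (A : Set X) : Prop :=
  ∀ x ∈ A, ∀ y ∈ A, E x y → F x y

theorem RelLEOn.mono {X : Type*} {E F : Setoid X} {A B : Set X} (h : RelLEOn E F B) (hAB : A ⊆ B) :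
    RelLEOn E F A :=
  fun x hx y hy => h x (hAB hx) y (hAB hy)

/-- Let `N S` be the set of `E \ F`-neighbours of `S`. Separating `A` from `N A` gives `B₀`; by
symmetry `A` misses `N B₀`, and separating these gives `B₁`. No edge of `E \ F` then joins two
points of `B₀ ∩ B₁`. -/
theorem RelLEOn.exists_isBorelTransversal [T2Space X] {E F : Setoid X}
    (hE : AnalyticSet (graph E)) (hF : IsBorel (graph F)) {A : Set X} (hA : AnalyticSet A)
    (hAEF : RelLEOn E F A) : ∃ B, IsBorelTransversal E F B ∧ A ⊆ B := by
  have hH := analyticSet_graph_inf hE hF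
  have hG := analyticSet_graph_diff hE hF
  let N : Set X → Set X := fun S => {y | ∃ x ∈ S, (x, y) ∈ graph E \ graph F}
  have hN : ∀ S, IsInvariant (E ⊓ F) (N S) := by
    have h1 : ∀ S x y, (E ⊓ F) x y → x ∈ N S → y ∈ N S := by
      rintro S x y hxy ⟨z, hz, hzx, hzx'⟩
      exact ⟨z, hz, E.trans hzx hxy.1, fun h => hzx' (F.trans h (F.symm hxy.2))⟩
    exact fun S x y hxy => ⟨h1 S x y hxy, h1 S y x ((E ⊓ F).symm hxy)⟩
  obtain ⟨B₀, hB₀, hB₀i, hAB₀, hB₀d⟩ := exists_isInvariant_isBorel_separating hH hA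
    (hG.image_of_rel hA) (hN A) (by
      rw [disjoint_left]
      rintro y hy ⟨x, hx, hxy, hxy'⟩
      exact hxy' (hAEF x hx y hy hxy))
  have hB₀a : AnalyticSet B₀ := by
    simpa using (analyticSet_univ_of_graph hE).inter_isBorel hB₀
  obtain ⟨B₁, hB₁, hB₁i, hAB₁, hB₁d⟩ := exists_isInvariant_isBorel_separating hH hA
    (hG.image_of_rel hB₀a) (hN B₀) (by
      rw [disjoint_left]
      rintro y hy ⟨x, hx, hxy, hxy'⟩
      exact disjoint_left.1 hB₀d hx ⟨y, hy, E.symm hxy, fun h => hxy' (F.symm h)⟩)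
  refine ⟨B₀ ∩ B₁, ⟨MeasurableSet.inter hB₀ hB₁,
    fun x y hxy => and_congr (hB₀i x y hxy) (hB₁i x y hxy),
    fun x hx y hy => ⟨fun hxy => ⟨hxy, ?_⟩, fun h => h.1⟩⟩, subset_inter hAB₀ hAB₁⟩
  by_contra hF'
  exact disjoint_left.1 hB₁d hy.2 ⟨x, hx.1, hxy, hF'⟩

/-- The complement of `Y` is a countable union of `E ⊓ F`-invariant Borel partial transversals of
`E` over `E ⊓ F`. -/
def IsCoSmall (E F : Setoid X) (Y : Set X) : Prop :=
  ∃ S : Set (Set X), S.Countable ∧ (∀ B ∈ S, IsBorelTransversal E F B) ∧ Yᶜ = ⋃₀ S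

variable {E F : Setoid X}

theorem IsBorelTransversal.isCoSmall_compl {B : Set X} (hB : IsBorelTransversal E F B) :
    IsCoSmall E F Bᶜ :=
  ⟨{B}, countable_singleton B, by simpa using hB, by simp⟩

theorem isCoSmall_univ : IsCoSmall E F (univ : Set X) :=
  ⟨∅, countable_empty, by simp, by simp⟩

theorem IsCoSmall.iInter {ι : Type*} [Countable ι] {Y : ι → Set X}
    (h : ∀ i, IsCoSmall E F (Y i)) : IsCoSmall E F (⋂ i, Y i) := by
  choose S hS hS' hY using h
  refine ⟨⋃ i, S i, countable_iUnion hS, fun B hB => ?_, ?_⟩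
  · obtain ⟨i, hi⟩ := mem_iUnion.1 hB
    exact hS' i B hi
  · rw [compl_iInter, sUnion_iUnion]
    simp_rw [hY]

theorem IsCoSmall.inter {Y Z : Set X} (hY : IsCoSmall E F Y) (hZ : IsCoSmall E F Z) :
    IsCoSmall E F (Y ∩ Z) := by
  rw [inter_eq_iInter]
  exact IsCoSmall.iInter fun b => by cases b <;> assumption

theorem IsCoSmall.isBorel {Y : Set X} (hY : IsCoSmall E F Y) : IsBorel Y := by
  obtain ⟨S, hS, hS', h⟩ := hY
  refine MeasurableSet.of_compl (m := borel X) ?_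
  rw [h]
  exact @MeasurableSet.sUnion X (borel X) S hS fun B hB => (hS' B hB).isBorel

theorem IsCoSmall.exists_iUnion_eq_univ (h : IsCoSmall E F (∅ : Set X)) :
    ∃ B : ℕ → Set X, (∀ n, IsBorelTransversal E F (B n)) ∧ ⋃ n, B n = univ := by
  obtain ⟨S, hS, hS', hu⟩ := h
  -- The empty transversal is added so that the family is nonempty and can be enumerated by `ℕ`.
  have h0 : IsBorelTransversal E F (∅ : Set X) :=
    ⟨@MeasurableSet.empty X (borel X), fun _ _ _ => Iff.rfl, by simp [IsPartialTransversal]⟩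
  obtain ⟨B, hB⟩ := (hS.insert ∅).exists_eq_range (insert_nonempty ∅ S)
  refine ⟨B, fun n => ?_, ?_⟩
  · obtain h | h : B n ∈ insert ∅ S := hB ▸ mem_range_self n
    · rwa [h]
    · exact hS' _ h
  · rw [← sUnion_range, ← hB, sUnion_insert, ← hu]
    simp

end Separation

/-! ### Finite approximations of homomorphisms from `𝔾₀` -/

section Configurations

open QuotientDichotomy

/-- Finite binary trees whose `2 ^ n` vertices and `2 ^ n - 1` edges are labelled by `α`. -/
def LabelledTree (α : Type*) : ℕ → Type _
  | 0 => α
  | n + 1 => (LabelledTree α n × LabelledTree α n) × α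

namespace LabelledTree

variable {α β : Type*}

instance instCountable [Countable α] : ∀ n, Countable (LabelledTree α n)
  | 0 => inferInstanceAs (Countable α)
  | n + 1 =>
    have := instCountable n
    inferInstanceAs (Countable ((LabelledTree α n × LabelledTree α n) × α))

instance instTopologicalSpace [TopologicalSpace α] : ∀ n, TopologicalSpace (LabelledTree α n)
  | 0 => inferInstanceAs (TopologicalSpace α)
  | n + 1 =>
    have := instTopologicalSpace n
    inferInstanceAs (TopologicalSpace ((LabelledTree α n × LabelledTree α n) × α))

instance instPolishSpace [TopologicalSpace α] [PolishSpace α] : ∀ n, PolishSpace (LabelledTree α n)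
  | 0 => inferInstanceAs (PolishSpace α)
  | n + 1 =>
    have := instPolishSpace n
    inferInstanceAs (PolishSpace ((LabelledTree α n × LabelledTree α n) × α))

/-- Apply a function to all labels. -/
def map (h : α → β) : ∀ n, LabelledTree α n → LabelledTree β n
  | 0, a => h a
  | n + 1, ((l, r), w) => ((map h n l, map h n r), h w)

/-- The label of the vertex `c`, of which only the first `n` coordinates matter. -/
def vertex : ∀ n, LabelledTree α n → (ℕ → Bool) → α
  | 0, a, _ => a
  | n + 1, ((l, r), _), c => bif c n then vertex n r c else vertex n l c

/-- The label of the edge at level `k` above `c`. -/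
def edge [Inhabited α] : ∀ n, LabelledTree α n → ℕ → (ℕ → Bool) → α
  -- A junk value: edges at level `k` exist only when `k < n`.
  | 0, _, _, _ => default
  | n + 1, ((l, r), w), k, c =>
    if k = n then w else bif c n then edge n r k c else edge n l k c

theorem continuous_vertex [TopologicalSpace α] (c : ℕ → Bool) :
    ∀ n, Continuous fun t : LabelledTree α n => vertex n t c
  | 0 => continuous_id
  | n + 1 => by
    have ih := continuous_vertex c n
    change Continuous fun t : (LabelledTree α n × LabelledTree α n) × α =>
      bif c n then vertex n t.1.2 c else vertex n t.1.1 c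
    cases c n
    · exact ih.comp (continuous_fst.comp continuous_fst)
    · exact ih.comp (continuous_snd.comp continuous_fst)

theorem vertex_congr {c d : ℕ → Bool} :
    ∀ (n) (t : LabelledTree α n), (∀ i < n, c i = d i) → vertex n t c = vertex n t d
  | 0, _, _ => rfl
  | n + 1, ((l, r), w), h => by
    simp only [vertex, h n n.lt_succ_self]
    rw [vertex_congr n l fun i hi => h i (hi.trans n.lt_succ_self),
      vertex_congr n r fun i hi => h i (hi.trans n.lt_succ_self)]

theorem vertex_map (h : α → β) (c : ℕ → Bool) :
    ∀ (n) (t : LabelledTree α n), vertex n (map h n t) c = h (vertex n t c)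
  | 0, _ => rfl
  | n + 1, ((l, r), w) => by
    simp only [vertex, map, vertex_map h c n]
    cases c n <;> rfl

theorem edge_congr_of_map_res {m k : ℕ} {c : ℕ → Bool} :
    ∀ (n) (t t' : LabelledTree (ℕ → ℕ) n), k < n →
      map (fun x => PiNat.res x m) n t = map (fun x => PiNat.res x m) n t' →
      PiNat.res (edge n t k c) m = PiNat.res (edge n t' k c) m
  | 0, _, _, hk, _ => absurd hk k.not_lt_zero
  | n + 1, ((l, r), w), ((l', r'), w'), hk, h => by
    obtain ⟨h', hw⟩ := Prod.mk.inj h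
    obtain ⟨hl, hr⟩ := Prod.mk.inj h'
    simp only [edge]
    split_ifs with hkn
    · exact hw
    · have hk' : k < n := by omega
      cases c n
      · exact edge_congr_of_map_res n l l' hk' hl
      · exact edge_congr_of_map_res n r r' hk' hr

theorem isOpen_setOf_res_eq (m : ℕ) (l : List ℕ) : IsOpen {x : ℕ → ℕ | PiNat.res x m = l} := by
  rw [isOpen_iff_forall_mem_open]
  rintro x rfl
  exact ⟨PiNat.cylinder x m, fun y hy => PiNat.res_eq_res.2 hy,
    PiNat.isOpen_cylinder (fun _ => ℕ) x m, PiNat.self_mem_cylinder x m⟩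

theorem isOpen_setOf_map_res_eq (m : ℕ) :
    ∀ (n) (a : LabelledTree (List ℕ) n),
      IsOpen {t : LabelledTree (ℕ → ℕ) n | map (fun x => PiNat.res x m) n t = a}
  | 0, a => isOpen_setOf_res_eq m a
  | n + 1, ((l, r), w) => by
    convert! ((isOpen_setOf_map_res_eq m n l).prod (isOpen_setOf_map_res_eq m n r)).prod
      (isOpen_setOf_res_eq m w) using 1
    ext t
    obtain ⟨⟨l', r'⟩, w'⟩ := t
    exact ⟨fun h => ⟨Prod.mk.inj (Prod.mk.inj h).1, (Prod.mk.inj h).2⟩,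
      fun h => Prod.ext (Prod.ext h.1.1 h.1.2) h.2⟩

end LabelledTree

open LabelledTree

variable {X : Type*} (f : (ℕ → ℕ) → X) (g : (ℕ → ℕ) → X × X) (s : ℕ → ℕ → Bool)

/-- The trees whose vertices are labelled by codes (under `f`) of points of `Y` and whose edges
are labelled by codes (under `g`) of the pairs of points at their ends. -/
def configurations (Y : Set X) : ∀ n, Set (LabelledTree (ℕ → ℕ) n)
  | 0 => f ⁻¹' Y
  | n + 1 => {t : (LabelledTree (ℕ → ℕ) n × LabelledTree (ℕ → ℕ) n) × (ℕ → ℕ) |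
      t.1.1 ∈ configurations Y n ∧ t.1.2 ∈ configurations Y n ∧
        g t.2 = (f (vertex n t.1.1 (s n)), f (vertex n t.1.2 (s n)))}

variable {f g s}

theorem configurations_mono {Y Z : Set X} (hYZ : Y ⊆ Z) :
    ∀ n, configurations f g s Y n ⊆ configurations f g s Z n
  | 0 => preimage_mono hYZ
  | n + 1 => fun _ ht =>
    ⟨configurations_mono hYZ n ht.1, configurations_mono hYZ n ht.2.1, ht.2.2⟩

theorem vertex_mem_of_mem_configurations {Y : Set X} (c : ℕ → Bool) :
    ∀ n, ∀ t ∈ configurations f g s Y n, f (vertex n t c) ∈ Y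
  | 0, _, ht => ht
  | n + 1, ((l, r), w), ht => by
    simp only [vertex]
    cases c n
    · exact vertex_mem_of_mem_configurations c n l ht.1
    · exact vertex_mem_of_mem_configurations c n r ht.2.1

/-- Above level `k` the sequences agree, so the recursion follows both into the same subtree; at
level `k` they part, and both reach the vertex `s k` of their halves. -/
theorem edge_of_mem_configurations {Y : Set X} {k : ℕ} {c d : ℕ → Bool} (hck : c k = false)
    (hdk : d k = true) (hc : ∀ i < k, c i = s k i) (hd : ∀ i < k, d i = s k i)
    (hcd : ∀ i, k < i → c i = d i) :
    ∀ n, ∀ t ∈ configurations f g s Y n, k < n →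
      g (edge n t k c) = (f (vertex n t c), f (vertex n t d))
  | 0, _, _, hk => absurd hk k.not_lt_zero
  | n + 1, ((l, r), w), ht, hk => by
    simp only [vertex, edge]
    split_ifs with hkn
    · subst hkn
      rw [hck, hdk, cond_false, cond_true, vertex_congr k l hc, vertex_congr k r hd]
      exact ht.2.2
    · have hk' : k < n := by omega
      rw [← hcd n hk']
      cases c n
      · exact edge_of_mem_configurations hck hdk hc hd hcd n l ht.1 hk'
      · exact edge_of_mem_configurations hck hdk hc hd hcd n r ht.2.1 hk'

variable (f g s) in
/-- The points labelling the vertex `s n` in the configurations in `Y` approximated by `a`. -/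
def approximated (Y : Set X) (n : ℕ) (a : LabelledTree (List ℕ) n) : Set X :=
  (fun t => f (vertex n t (s n))) ''
    (configurations f g s Y n ∩ {t | map (fun x => PiNat.res x n) n t = a})

theorem approximated_mono {Y Z : Set X} (hYZ : Y ⊆ Z) (n : ℕ) (a : LabelledTree (List ℕ) n) :
    approximated f g s Y n a ⊆ approximated f g s Z n a :=
  image_mono (inter_subset_inter_left _ (configurations_mono hYZ n))

variable [TopologicalSpace X] [T2Space X]

/-- The gluing condition at each level is an equality of continuous functions, hence closed because
`X` is Hausdorff. -/
theorem analyticSet_configurations (hf : Continuous f) (hg : Continuous g) {Y : Set X}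
    (hY : IsBorel Y) : ∀ n, AnalyticSet (configurations f g s Y n)
  | 0 => by
    borelize X (ℕ → ℕ)
    exact (hf.measurable hY).analyticSet
  | n + 1 => by
    have ih := analyticSet_configurations hf hg hY n
    have : PolishSpace ((LabelledTree (ℕ → ℕ) n × LabelledTree (ℕ → ℕ) n) × (ℕ → ℕ)) :=
      instPolishSpace (n + 1)
    have h1 := ih.preimage
      (f := fun t : (LabelledTree (ℕ → ℕ) n × LabelledTree (ℕ → ℕ) n) × (ℕ → ℕ) => t.1.1)
      (by fun_prop)
    have h2 := ih.preimage
      (f := fun t : (LabelledTree (ℕ → ℕ) n × LabelledTree (ℕ → ℕ) n) × (ℕ → ℕ) => t.1.2)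
      (by fun_prop)
    have hv := continuous_vertex (α := ℕ → ℕ) (s n) n
    have h3 : IsClosed
        {t : (LabelledTree (ℕ → ℕ) n × LabelledTree (ℕ → ℕ) n) × (ℕ → ℕ) |
          g t.2 = (f (vertex n t.1.1 (s n)), f (vertex n t.1.2 (s n)))} :=
      isClosed_eq (by fun_prop) (by fun_prop)
    borelize ((LabelledTree (ℕ → ℕ) n × LabelledTree (ℕ → ℕ) n) × (ℕ → ℕ))
    have h4 := AnalyticSet.iInter (s := fun b : Bool => bif b then
      (fun t : (LabelledTree (ℕ → ℕ) n × LabelledTree (ℕ → ℕ) n) × (ℕ → ℕ) => t.1.1) ⁻¹'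
        configurations f g s Y n else
      (fun t : (LabelledTree (ℕ → ℕ) n × LabelledTree (ℕ → ℕ) n) × (ℕ → ℕ) => t.1.2) ⁻¹'
        configurations f g s Y n) (by rintro (_ | _); exacts [h2, h1])
    convert! h4.inter_isBorel h3.measurableSet using 1
    ext t
    constructor
    · exact fun h => ⟨mem_iInter.2 (by rintro (_ | _); exacts [h.2.1, h.1]), h.2.2⟩
    · exact fun h => ⟨mem_iInter.1 h.1 true, mem_iInter.1 h.1 false, h.2⟩

theorem analyticSet_approximated (hf : Continuous f) (hg : Continuous g) {Y : Set X}
    (hY : IsBorel Y) (n : ℕ) (a : LabelledTree (List ℕ) n) :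
    AnalyticSet (approximated f g s Y n a) := by
  borelize (LabelledTree (ℕ → ℕ) n)
  exact ((analyticSet_configurations hf hg hY n).inter_isBorel
    (isOpen_setOf_map_res_eq n n a).measurableSet).image_of_continuous
      (hf.comp (continuous_vertex (s n) n))

end Configurations

/-! ### The dichotomy: transversals covering `X` or a homomorphism from `𝔾₀` -/

section Dichotomy

open QuotientDichotomy LabelledTree

theorem LabelledTree.continuous_vertex_right {α : Type*} [TopologicalSpace α] (n : ℕ)
    (t : LabelledTree α n) : Continuous (vertex n t) := by
  refine continuous_def.2 fun U _ => isOpen_iff_forall_mem_open.2 fun c hc =>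
    ⟨_, fun d hd => ?_, isOpen_setOf_forall_lt_eq c n, fun _ _ => rfl⟩
  rwa [mem_preimage, vertex_congr n t hd]

/-- A sequence of sequences whose `n`-th and `n + 1`-st terms agree below `n` from some point on
converges. -/
theorem exists_tendsto_of_forall_succ_eq {x : ℕ → ℕ → ℕ} (N : ℕ)
    (h : ∀ n, N ≤ n → ∀ i < n, x (n + 1) i = x n i) :
    ∃ y, Tendsto x atTop (𝓝 y) ∧ ∀ n, N ≤ n → ∀ i < n, y i = x n i := by
  have key : ∀ n, N ≤ n → ∀ i < n, x (max N (i + 1)) i = x n i := by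
    intro n hn i hi
    have hle : max N (i + 1) ≤ n := max_le hn hi
    induction n, hle using Nat.le_induction with
    | base => rfl
    | succ n hmn ih =>
      rw [max_le_iff] at hmn
      rw [h n hmn.1 i hmn.2]
      exact ih hmn.1 hmn.2
  refine ⟨fun i => x (max N (i + 1)) i, tendsto_pi_nhds.2 fun i => ?_, key⟩
  refine tendsto_const_nhds.congr' ?_
  filter_upwards [eventually_ge_atTop (max N (i + 1))] with n hn
  exact key n (le_trans (le_max_left _ _) hn) i (le_trans (le_max_right _ _) hn)

variable {X : Type*} [TopologicalSpace X] [T2Space X]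
  {f : (ℕ → ℕ) → X} {g : (ℕ → ℕ) → X × X} {s : ℕ → ℕ → Bool}

/-- A sequence of configurations approximating each other yields a homomorphism from `𝔾₀` to the
range of `g`. -/
theorem exists_homomorphism_of_configurations (hf : Continuous f) (hg : Continuous g) {Y : Set X}
    {γ : ∀ n, LabelledTree (ℕ → ℕ) n} (hγ : ∀ n, γ n ∈ configurations f g s Y n)
    (hstep : ∀ n, ∃ l r w, γ (n + 1) = ((l, r), w) ∧
      map (fun x => PiNat.res x n) n l = map (fun x => PiNat.res x n) n (γ n) ∧
      map (fun x => PiNat.res x n) n r = map (fun x => PiNat.res x n) n (γ n)) :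
    ∃ p : (ℕ → Bool) → X, Continuous p ∧ ∀ k c, c k = false → (∀ i < k, c i = s k i) →
      (p c, p (flipCoords {k} c)) ∈ range g := by
  have hv : ∀ c n, 0 ≤ n → ∀ i < n, vertex (n + 1) (γ (n + 1)) c i = vertex n (γ n) c i := by
    intro c n _ i hi
    obtain ⟨l, r, w, hlr, hl, hr⟩ := hstep n
    have hl' := congrArg (fun t => vertex n t c) hl
    have hr' := congrArg (fun t => vertex n t c) hr
    simp only [vertex_map] at hl' hr'
    rw [hlr]
    simp only [vertex]
    cases c n
    · exact PiNat.res_eq_res.1 hl' hi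
    · exact PiNat.res_eq_res.1 hr' hi
  have he : ∀ k c n, k + 1 ≤ n → ∀ i < n,
      edge (n + 1) (γ (n + 1)) k c i = edge n (γ n) k c i := by
    intro k c n hk i hi
    obtain ⟨l, r, w, hlr, hl, hr⟩ := hstep n
    rw [hlr]
    simp only [edge, if_neg (Nat.ne_of_lt hk)]
    cases c n
    · exact PiNat.res_eq_res.1 (edge_congr_of_map_res n _ _ hk hl) hi
    · exact PiNat.res_eq_res.1 (edge_congr_of_map_res n _ _ hk hr) hi
  choose φ hφ hφ' using fun c => exists_tendsto_of_forall_succ_eq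
    (x := fun n => vertex n (γ n) c) 0 (hv c)
  refine ⟨f ∘ φ, hf.comp (continuous_pi fun i => ?_), fun k c hck hcs => ?_⟩
  · simp_rw [fun c => hφ' c (i + 1) (Nat.zero_le _) i i.lt_succ_self]
    exact (continuous_apply i).comp (continuous_vertex_right (i + 1) (γ (i + 1)))
  · obtain ⟨ψ, hψ, -⟩ := exists_tendsto_of_forall_succ_eq
      (x := fun n => edge n (γ n) k c) (k + 1) (he k c)
    -- Both sides are limits of the same sequence for `n > k`: the images under `g` of edge labels
    -- are the pairs of images under `f` of the end labels.
    refine ⟨ψ, tendsto_nhds_unique ((hg.tendsto ψ).comp hψ) ?_⟩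
    have hlim := ((hf.tendsto _).comp (hφ c)).prodMk_nhds
      ((hf.tendsto _).comp (hφ (flipCoords {k} c)))
    refine hlim.congr' ?_
    filter_upwards [eventually_gt_atTop k] with n hn
    refine (edge_of_mem_configurations (s := s) hck ?_ hcs (fun i hi => ?_) (fun i hi => ?_) n _
      (hγ n) hn).symm
    · simp [flipCoords_apply, hck]
    · simp [flipCoords_apply, hcs i hi, hi.ne]
    · simp [flipCoords_apply, hi.ne']

/-- Either the space is a countable union of `E ⊓ F`-invariant Borel partial transversals of `E`
over `E ⊓ F`, or there is a continuous homomorphism from the graph `𝔾₀` to `E \ F`. -/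
theorem isCoSmall_empty_or_exists_homomorphism {E F : Setoid X} (hE : AnalyticSet (graph E))
    (hF : IsBorel (graph F)) (s : ℕ → ℕ → Bool) :
    IsCoSmall E F (∅ : Set X) ∨ ∃ p : (ℕ → Bool) → X, Continuous p ∧
      ∀ k c, c k = false → (∀ i < k, c i = s k i) →
        E (p c) (p (flipCoords {k} c)) ∧ ¬ F (p c) (p (flipCoords {k} c)) := by
  have hX := analyticSet_univ_of_graph hE
  have hcover : ∀ A : Set X, AnalyticSet A → RelLEOn E F A →
      ∃ B, IsBorelTransversal E F B ∧ A ⊆ B :=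
    fun A hA hAEF => hAEF.exists_isBorelTransversal hE hF hA
  rw [or_iff_not_imp_left]
  intro hsmall
  have hindep : ∀ Y, IsCoSmall E F Y → ¬ RelLEOn E F Y := by
    intro Y hY hYEF
    obtain ⟨B, hB, hYB⟩ := hcover Y (by simpa using hX.inter_isBorel hY.isBorel) hYEF
    refine hsmall ?_
    convert hY.inter hB.isCoSmall_compl
    exact (disjoint_compl_right_iff_subset.2 hYB).inter_eq.symm
  obtain ⟨f, hf, hfX⟩ : ∃ f : (ℕ → ℕ) → X, Continuous f ∧ range f = univ := by
    rw [AnalyticSet] at hX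
    refine hX.resolve_left fun h => hindep univ isCoSmall_univ ?_
    rw [h]
    exact fun x hx => hx.elim
  obtain ⟨g, hg, hgEF⟩ : ∃ g : (ℕ → ℕ) → X × X, Continuous g ∧ range g = graph E \ graph F := by
    have := analyticSet_graph_diff hE hF
    rw [AnalyticSet] at this
    refine this.resolve_left fun h => hindep univ isCoSmall_univ fun x _ y _ hxy => ?_
    exact sdiff_eq_empty.1 h (show (x, y) ∈ graph E from hxy)
  let A : Set X → (Σ n, LabelledTree (List ℕ) n) → Set X := fun Y q => approximated f g s Y q.1 q.2
  have hA : ∀ Y, IsBorel Y → ∀ q, AnalyticSet (A Y q) :=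
    fun Y hY q => analyticSet_approximated hf hg hY q.1 q.2
  -- There are only countably many approximations `q`, so one co-small `Y` makes `E` contained in
  -- `F` on every `A Y q` for which some co-small set does so.
  obtain ⟨Y, hY, hYmax⟩ : ∃ Y, IsCoSmall E F Y ∧
      ∀ q Z, IsCoSmall E F Z → RelLEOn E F (A Z q) → RelLEOn E F (A Y q) := by
    have : ∀ q, ∃ Y, IsCoSmall E F Y ∧
        ∀ Z, IsCoSmall E F Z → RelLEOn E F (A Z q) → RelLEOn E F (A Y q) := by
      intro q
      by_cases h : ∃ Z, IsCoSmall E F Z ∧ RelLEOn E F (A Z q)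
      · obtain ⟨Z, hZ, hZq⟩ := h
        exact ⟨Z, hZ, fun _ _ _ => hZq⟩
      · exact ⟨univ, isCoSmall_univ, fun Z hZ hZq => (h ⟨Z, hZ, hZq⟩).elim⟩
    choose Y hY hYmax using this
    exact ⟨⋂ q, Y q, IsCoSmall.iInter hY, fun q Z hZ hZq =>
      (hYmax q Z hZ hZq).mono (approximated_mono (iInter_subset Y q) _ _)⟩
  -- The sets `A Y q` on which `E` is contained in `F` are covered by transversals, whose removal
  -- leaves `Y'`.
  obtain ⟨Y', hY', hYY', hYdisj⟩ : ∃ Y', IsCoSmall E F Y' ∧ Y' ⊆ Y ∧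
      ∀ q, RelLEOn E F (A Y q) → Disjoint (A Y q) Y' := by
    have : ∀ q, ∃ Z, IsCoSmall E F Z ∧ (RelLEOn E F (A Y q) → Disjoint (A Y q) Z) := by
      intro q
      by_cases h : RelLEOn E F (A Y q)
      · obtain ⟨B, hB, hAB⟩ := hcover _ (hA Y hY.isBorel q) h
        exact ⟨Bᶜ, hB.isCoSmall_compl, fun _ => disjoint_compl_right_iff_subset.2 hAB⟩
      · exact ⟨univ, isCoSmall_univ, fun h' => (h h').elim⟩
    choose Z hZ hZd using this
    exact ⟨Y ∩ ⋂ q, Z q, hY.inter (IsCoSmall.iInter hZ), inter_subset_left, fun q hq =>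
      (hZd q hq).mono_right (inter_subset_right.trans (iInter_subset Z q))⟩
  -- By the choice of `Y`, an `E \ F`-edge survives inside `A Y' ⟨n, a⟩`, and its two configurations
  -- are glued along it. The result has all its vertices in `Y'`, so its own approximation was not
  -- removed and can be extended again.
  have hext : ∀ n (a : LabelledTree (List ℕ) n), ¬ RelLEOn E F (A Y ⟨n, a⟩) →
      ∃ l r w, map (fun x => PiNat.res x n) n l = a ∧ map (fun x => PiNat.res x n) n r = a ∧
        ((l, r), w) ∈ configurations f g s Y (n + 1) ∧
        ¬ RelLEOn E F
          (A Y ⟨n + 1, map (fun x => PiNat.res x (n + 1)) (n + 1) ((l, r), w)⟩) := by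
    intro n a ha
    have ha' : ¬ RelLEOn E F (A Y' ⟨n, a⟩) := fun h => ha (hYmax _ Y' hY' h)
    simp only [RelLEOn, not_forall] at ha'
    obtain ⟨_, ⟨l, ⟨hl, hla⟩, rfl⟩, _, ⟨r, ⟨hr, hra⟩, rfl⟩, hEr, hFr⟩ := ha'
    obtain ⟨w, hw⟩ : (f (vertex n l (s n)), f (vertex n r (s n))) ∈ range g :=
      hgEF ▸ ⟨hEr, hFr⟩
    have hmem : ((l, r), w) ∈ configurations f g s Y' (n + 1) := ⟨hl, hr, hw⟩
    refine ⟨l, r, w, hla, hra, configurations_mono hYY' _ hmem, fun h => ?_⟩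
    exact disjoint_left.1 (hYdisj _ h)
      ⟨((l, r), w), ⟨configurations_mono hYY' _ hmem, rfl⟩, rfl⟩
      (vertex_mem_of_mem_configurations (s (n + 1)) (n + 1) _ hmem)
  let T : ℕ → Type := fun n => {t : LabelledTree (ℕ → ℕ) n // t ∈ configurations f g s Y n ∧
    ¬ RelLEOn E F (A Y ⟨n, map (fun x => PiNat.res x n) n t⟩)}
  have hT0 : Nonempty (T 0) := by
    -- At level `0` the empty list imposes no constraint, so the approximated set is all of `Y`.
    have h0 : ¬ RelLEOn E F (A Y ⟨0, ([] : List ℕ)⟩) := by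
      refine fun h => hindep Y hY (h.mono fun y hy => ?_)
      obtain ⟨z, rfl⟩ : y ∈ range f := hfX ▸ mem_univ y
      exact ⟨z, ⟨hy, rfl⟩, rfl⟩
    have h1 := h0
    simp only [RelLEOn, not_forall] at h1
    obtain ⟨_, ⟨t, ⟨ht, -⟩, -⟩, -⟩ := h1
    exact ⟨t, ht, h0⟩
  have hTs : ∀ n (t : T n), ∃ t' : T (n + 1), ∃ l r w, t'.1 = ((l, r), w) ∧
      map (fun x => PiNat.res x n) n l = map (fun x => PiNat.res x n) n t.1 ∧
      map (fun x => PiNat.res x n) n r = map (fun x => PiNat.res x n) n t.1 := by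
    intro n t
    obtain ⟨l, r, w, hl, hr, hm, hn⟩ := hext n _ t.2.2
    exact ⟨⟨((l, r), w), hm, hn⟩, l, r, w, rfl, hl, hr⟩
  choose next hnext using hTs
  let γ : ∀ n, T n := fun n => Nat.rec hT0.some (fun n t => next n t) n
  obtain ⟨p, hp, hom⟩ := exists_homomorphism_of_configurations (s := s) hf hg
    (fun n => (γ n).2.1) fun n => hnext n (γ n)
  refine ⟨p, hp, fun k c h1 h2 => ?_⟩
  have := hom k c h1 h2
  rwa [hgEF] at this

end Dichotomy

theorem mainTheorem5 {X : Type*} [TopologicalSpace X] [T2Space X] (E F : Setoid X)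
    (hE : MeasureTheory.AnalyticSet (QuotientDichotomy.graph E))
    (hE0 : ¬ QuotientDichotomy.ContinuouslyEmbeds QuotientDichotomy.E0 E)
    (hF : QuotientDichotomy.IsBorel (QuotientDichotomy.graph F))
    (hEF : QuotientDichotomy.ClassesAreCountableUnions E (E ⊓ F)) :
    ∃ B : ℕ → Set X,
      (∀ n, QuotientDichotomy.IsBorel (B n) ∧
        QuotientDichotomy.IsInvariant (E ⊓ F) (B n) ∧
        QuotientDichotomy.IsPartialTransversal E (E ⊓ F) (B n)) ∧
      ⋃ n, B n = Set.univ := by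
  obtain ⟨s, hs⟩ := exists_isDenseInTree
  obtain h | ⟨p, hp, hom⟩ := isCoSmall_empty_or_exists_homomorphism hE hF s
  · obtain ⟨B, hB, hBX⟩ := h.exists_iUnion_eq_univ
    exact ⟨B, fun n => ⟨(hB n).isBorel, (hB n).isInvariant, (hB n).isPartialTransversal⟩, hBX⟩
  · exact (hE0 (continuouslyEmbeds_E0_of_homomorphism hE hF hEF hs hp hom)).elim
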